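/- Theorem 1.2. All graphs are finite and simple. Let $G$ be a graph and $S \subseteq V(G)$. Initially all vertices of $S$ and all neighbors of vertices of $S$ are observed; then, repeatedly, every vertex that is the only unobserved neighbor of some observed vertex becomes observed. The set $S$ is a power dominating set of $G$ if every vertex of $G$ is eventually observed, and the power domination number $\gamma_P(G)$ is the least cardinality of a power dominating set of $G$. A graph is cubic if every vertex has degree $3$; it is claw-free if it has no induced subgraph isomorphic to $K_{1,3}$; and it is diamond-free if it has no subgraph (induced or not) isomorphic to the diamond, that is, $K_4$ minus one edge (so $K_4$ itself is not diamond-free). Every claw-free diamond-free cubic graph $G$ of order $n$, connected or not, satisfies $$\gamma_P(G) \le \frac{n}{6}.$$ The bound is sharp: for every integer $k \ge 1$ there is a connected claw-free diamond-free cubic graph $G$ of order $n = 6k$ with $\gamma_P(G) = n/6$. -/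

import Mathlib

namespace PowerDomination

variable {V : Type*}

/-- The vertices of `G` that are eventually observed when `S` is the initial set.
`mem` and `adj` are the domination step, applied once to `S`; `propagate` is the propagation step,
repeated as often as needed: an observed vertex `v` all of whose neighbors other than `w` are
observed makes its neighbor `w` observed. -/
inductive Observed (G : SimpleGraph V) (S : Set V) : V → Prop
  | mem {v : V} (hv : v ∈ S) : Observed G S v
  | adj {v w : V} (hv : v ∈ S) (hvw : G.Adj v w) : Observed G S w
  | propagate {v w : V} (hv : Observed G S v) (hvw : G.Adj v w)
      (h : ∀ u : V, G.Adj v u → u ≠ w → Observed G S u) : Observed G S w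

/-- `S` is a power dominating set of `G`: every vertex is eventually observed. -/
def IsPowerDominatingSet (G : SimpleGraph V) (S : Set V) : Prop :=
  ∀ v : V, Observed G S v

/-- The power domination number of a finite graph: the least cardinality of a power dominating
set. (The set of cardinalities is nonempty, since the set of all vertices is power dominating.) -/
noncomputable def powerDominationNumber [Fintype V] (G : SimpleGraph V) : ℕ :=
  sInf {k : ℕ | ∃ S : Finset V, IsPowerDominatingSet G (S : Set V) ∧ S.card = k}

/-- The claw `K_{1,3}`. -/
def claw : SimpleGraph (Fin 1 ⊕ Fin 3) := completeBipartiteGraph (Fin 1) (Fin 3)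

/-- The diamond `K_4 - e`. -/
def diamond : SimpleGraph (Fin 4) := (⊤ : SimpleGraph (Fin 4)).deleteEdges {s(0, 1)}

/-- `G` is claw-free: the claw is not an induced subgraph of `G`. -/
def ClawFree (G : SimpleGraph V) : Prop := ¬ claw.IsIndContained G

/-- `G` is diamond-free: `G` has no subgraph, induced or not, isomorphic to the diamond.
In particular `K_4` is not diamond-free. -/
def DiamondFree (G : SimpleGraph V) : Prop := diamond.Free G

end PowerDomination

namespace PowerDomination

open Finset

universe u

variable {V : Type u}

/-! In a claw-free diamond-free cubic graph every vertex lies in exactly one triangle and has one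
edge leaving it, so the graph is n/3 disjoint triangles joined by a perfect matching
(`exists_triangleMatching`). A maximum cut 2-colors the triangles so that each sends at most one
edge to its own color (`exists_coloring`). Select a vertex in each triangle of one color: these
triangles are observed at once, then their matching partners, which leaves at most one unobserved
vertex in every other triangle, and a vertex of that triangle forces it (`isPowerDominatingSet`).
The rarer color has at most n/6 triangles. For sharpness, every bead of the necklace must contain a
selected vertex (`not_observed_necklace`). -/

/-- A decomposition of a graph into disjoint triangles joined by a perfect matching: `t` assigns to
each vertex (the name of) its triangle and `f` its unique neighbor outside of that triangle. -/
structure TriangleMatching {T : Type*} (G : SimpleGraph V) (t : V → T) (f : V → V) : Prop where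
  adj_iff : ∀ u v, G.Adj u v ↔ (u ≠ v ∧ t u = t v) ∨ v = f u
  invol : ∀ v, f (f v) = v
  outer : ∀ v, t (f v) ≠ t v
  fiber : ∀ v, ∃ a b, a ≠ v ∧ b ≠ v ∧ a ≠ b ∧ ∀ u, t u = t v ↔ u = v ∨ u = a ∨ u = b

/-! ### Triangles joined by a perfect matching: the upper bound -/

namespace TriangleMatching

variable {T : Type*} {G : SimpleGraph V} {t : V → T} {f : V → V}

/-- Only one neighbor of a vertex lies outside its triangle, so two of any three are in that
triangle. -/
lemma clawFree (h : TriangleMatching G t f) : ClawFree G := by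
  rintro ⟨φ⟩
  have hc : ∀ i : Fin 3, G.Adj (φ (.inl 0)) (φ (.inr i)) := fun i => by
    rw [φ.map_adj_iff]; simp [claw]
  have hi : ∀ i j : Fin 3, i ≠ j → t (φ (.inr i)) ≠ t (φ (.inr j)) := fun i j hij ht => by
    have : G.Adj (φ (.inr i)) (φ (.inr j)) :=
      (h.adj_iff _ _).2 (.inl ⟨fun e => hij (Sum.inr_injective (φ.injective e)), ht⟩)
    rw [φ.map_adj_iff] at this
    simp [claw] at this
  have h0 := (h.adj_iff _ _).1 (hc 0)
  have h1 := (h.adj_iff _ _).1 (hc 1)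
  have h2 := (h.adj_iff _ _).1 (hc 2)
  have a01 := hi 0 1 (by decide)
  have a02 := hi 0 2 (by decide)
  have a12 := hi 1 2 (by decide)
  grind

lemma diamondFree (h : TriangleMatching G t f) : DiamondFree G := by
  rintro ⟨φ⟩
  have hadj : ∀ i j : Fin 4, diamond.Adj i j → G.Adj (φ i) (φ j) := fun i j hij =>
    φ.toHom.map_adj hij
  have hne : ∀ i j : Fin 4, i ≠ j → φ i ≠ φ j := fun i j hij e => hij (φ.injective e)
  have d : ∀ i j : Fin 4, i ≠ j → s(i, j) ≠ s(0, 1) → diamond.Adj i j := fun i j h1 h2 => by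
    simpa [diamond, SimpleGraph.deleteEdges_adj, h1] using h2
  have h23 := (h.adj_iff _ _).1 (hadj 2 3 (d _ _ (by decide) (by decide)))
  have h20 := (h.adj_iff _ _).1 (hadj 2 0 (d _ _ (by decide) (by decide)))
  have h21 := (h.adj_iff _ _).1 (hadj 2 1 (d _ _ (by decide) (by decide)))
  have h30 := (h.adj_iff _ _).1 (hadj 3 0 (d _ _ (by decide) (by decide)))
  have h31 := (h.adj_iff _ _).1 (hadj 3 1 (d _ _ (by decide) (by decide)))
  have n01 := hne 0 1 (by decide)
  have n02 := hne 0 2 (by decide)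
  have n03 := hne 0 3 (by decide)
  have n12 := hne 1 2 (by decide)
  have n13 := hne 1 3 (by decide)
  have n23 := hne 2 3 (by decide)
  have i2 := h.invol (φ 2)
  have i3 := h.invol (φ 3)
  have o2 := h.outer (φ 2)
  have o3 := h.outer (φ 3)
  -- An edge with a common neighbor cannot be a matching edge, so all four vertices share a
  -- triangle, which has only three.
  have key : t (φ 3) = t (φ 2) ∧ t (φ 0) = t (φ 2) ∧ t (φ 1) = t (φ 2) := by grind
  obtain ⟨a, b, -, -, -, hab⟩ := h.fiber (φ 2)
  have k3 := (hab _).1 key.1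
  have k0 := (hab _).1 key.2.1
  have k1 := (hab _).1 key.2.2
  grind

lemma isRegularOfDegree (h : TriangleMatching G t f) [G.LocallyFinite] :
    G.IsRegularOfDegree 3 := by
  classical
  intro v
  obtain ⟨a, b, hav, hbv, hab, hf⟩ := h.fiber v
  have ho := h.outer v
  have : G.neighborFinset v = {a, b, f v} := by
    ext u
    have := h.adj_iff v u
    have := hf u
    simp only [SimpleGraph.mem_neighborFinset, mem_insert, mem_singleton]
    grind
  rw [← SimpleGraph.card_neighborFinset_eq_degree, this, card_eq_three]
  have ha := (hf a).2 (by simp)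
  have hb := (hf b).2 (by simp)
  exact ⟨a, b, f v, hab, fun e => ho (e ▸ ha), fun e => ho (e ▸ hb), rfl⟩

/-- Local optimality of a maximum cut: the triangles can be colored with two colors such that each
triangle has at most one edge leading to a triangle of its own color. -/
lemma exists_coloring [Fintype V] (h : TriangleMatching G t f) :
    ∃ c : T → Bool, ∀ u v, u ≠ v → t u = t v →
      c (t (f u)) = c (t u) → c (t (f v)) = c (t v) → False := by
  classical
  let M : (T → Bool) → ℕ := fun c => #{v | c (t (f v)) = c (t v)}
  -- `M` counts ends of monochromatic matching edges, so minimizing it maximizes the cut.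
  obtain ⟨c, hc⟩ : ∃ c, ∀ c', M c ≤ M c' := ⟨Function.argmin M, fun c' => Function.argmin_le M c'⟩
  refine ⟨c, fun u v huv ht hu hv => ?_⟩
  let c' : T → Bool := Function.update c (t u) (!c (t u))
  -- An edge at the triangle of `u` has exactly one end in it, hence the factor 2; the last term is
  -- unaffected by recoloring that triangle.
  have split : ∀ d : T → Bool, M d =
      2 * #{v | t v = t u ∧ d (t (f v)) = d (t v)} +
        #{v | t v ≠ t u ∧ t (f v) ≠ t u ∧ d (t (f v)) = d (t v)} := fun d => by
    have e : #{v | t v = t u ∧ d (t (f v)) = d (t v)} =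
        #{v | t (f v) = t u ∧ d (t (f v)) = d (t v)} := by
      refine card_bij' (fun v _ => f v) (fun v _ => f v) ?_ ?_ ?_ ?_ <;>
        simp +contextual [h.invol]
    have e3 : (univ.filter fun v => d (t (f v)) = d (t v)) =
        ((univ.filter fun v => t v = t u ∧ d (t (f v)) = d (t v)) ∪
        (univ.filter fun v => t (f v) = t u ∧ d (t (f v)) = d (t v))) ∪
        (univ.filter fun v => t v ≠ t u ∧ t (f v) ≠ t u ∧ d (t (f v)) = d (t v)) := by
      ext v
      simp only [mem_filter, mem_univ, true_and, mem_union]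
      tauto
    have e4 : M d = #(univ.filter fun v => d (t (f v)) = d (t v)) := rfl
    rw [e4, e3, card_union_of_disjoint, card_union_of_disjoint, ← e, two_mul]
    · rw [disjoint_filter]
      rintro v - ⟨h1, -⟩ ⟨h2, -⟩
      exact h.outer v (h2.trans h1.symm)
    · rw [← filter_or, disjoint_filter]
      rintro v - h1 h2
      tauto
  have hle := hc c'
  rw [split c, split c'] at hle
  have e1 : #{v | t v ≠ t u ∧ t (f v) ≠ t u ∧ c' (t (f v)) = c' (t v)} =
      #{v | t v ≠ t u ∧ t (f v) ≠ t u ∧ c (t (f v)) = c (t v)} := by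
    congr 1
    ext v
    simp only [mem_filter, mem_univ, true_and]
    constructor <;> rintro ⟨h1, h2, h3⟩ <;> refine ⟨h1, h2, ?_⟩ <;>
      simpa [c', Function.update_of_ne h1, Function.update_of_ne h2] using h3
  have e2 : 1 < #{v | t v = t u ∧ c (t (f v)) = c (t v)} :=
    one_lt_card.2 ⟨u, by simp [hu], v, by simp [hv, ht], huv⟩
  obtain ⟨a, b, -, -, -, hab⟩ := h.fiber u
  obtain ⟨w, hw⟩ : ∃ w, ∀ x, t x = t u → x = u ∨ x = v ∨ x = w := by
    have := (hab v).1 ht.symm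
    by_cases hva : v = a
    · exact ⟨b, fun x hx => by have := (hab x).1 hx; grind⟩
    · exact ⟨a, fun x hx => by have := (hab x).1 hx; grind⟩
  -- After the flip the edges at `u` and `v` are bichromatic, so only `w` can count: a drop from at
  -- least 2 to at most 1.
  have e3 : #{v | t v = t u ∧ c' (t (f v)) = c' (t v)} ≤ 1 := by
    refine (card_le_card (t := {w}) fun x hx => ?_).trans (card_singleton w).le
    simp only [mem_filter, mem_univ, true_and] at hx
    obtain ⟨hx1, hx2⟩ := hx
    have hx3 : t (f x) ≠ t u := hx1 ▸ h.outer x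
    simp only [c', hx1, Function.update_self, Function.update_of_ne hx3] at hx2
    rcases hw x hx1 with rfl | rfl | rfl
    · simp [hu] at hx2
    · rw [hv, hx1] at hx2; simp at hx2
    · simp
  omega

lemma card_eq [Fintype V] [DecidableEq T] (h : TriangleMatching G t f) :
    Fintype.card V = 3 * #(univ.image t) := by
  rw [← card_univ, card_eq_sum_card_image t univ, sum_const_nat (m := 3), mul_comm]
  intro x hx
  obtain ⟨v, -, rfl⟩ := mem_image.1 hx
  classical
  obtain ⟨a, b, hav, hbv, hab, hf⟩ := h.fiber v
  rw [card_eq_three]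
  exact ⟨v, a, b, hav.symm, hbv.symm, hab, by ext u; simp [hf]⟩

/-- Choosing a vertex in every triangle of one color gives a power dominating set. -/
lemma isPowerDominatingSet (h : TriangleMatching G t f) {c : T → Bool}
    (hc : ∀ u v, u ≠ v → t u = t v → c (t (f u)) = c (t u) → c (t (f v)) = c (t v) → False)
    {S : Set V} {b : Bool} (hS : ∀ v, c (t v) = b → ∃ s ∈ S, t s = t v) :
    IsPowerDominatingSet G S := by
  have h1 : ∀ v, c (t v) = b → Observed G S v := fun v hv => by
    obtain ⟨s, hs, hst⟩ := hS v hv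
    by_cases hsv : s = v
    · exact hsv ▸ .mem hs
    · exact .adj hs ((h.adj_iff _ _).2 (.inl ⟨hsv, hst⟩))
  have h2 : ∀ v, c (t (f v)) = b → Observed G S v := fun v hv => by
    refine .propagate (h1 _ hv) ((h.adj_iff _ _).2 (.inr (h.invol v).symm)) fun u hu huv => ?_
    rcases (h.adj_iff _ _).1 hu with ⟨-, hu⟩ | hu
    · exact h1 u (hu ▸ hv)
    · exact absurd (hu.trans (h.invol v)) huv
  intro v
  by_cases hv : c (t v) = b
  · exact h1 v hv
  by_cases hfv : c (t (f v)) = b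
  · exact h2 v hfv
  -- The edge at `v` is already monochromatic, so the other two edges of its triangle lead to color
  -- `b`.
  have key : ∀ u, u ≠ v → t u = t v → c (t (f u)) = b := fun u hu huv => by
    by_contra hne
    have heq : ∀ x y : Bool, x ≠ b → y ≠ b → x = y := by cases b <;> decide
    exact hc u v hu huv (heq _ _ hne (huv ▸ hv)) (heq _ _ hfv hv)
  obtain ⟨x, y, hx, hy, hxy, hf⟩ := h.fiber v
  have hxt := (hf x).2 (by simp)
  refine .propagate (h2 x (key x hx hxt)) ((h.adj_iff _ _).2 (.inl ⟨hx, hxt⟩)) fun u hu huv => ?_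
  rcases (h.adj_iff _ _).1 hu with ⟨-, hu⟩ | rfl
  · exact h2 u (key u huv (hu ▸ hxt))
  · exact h1 _ (key x hx hxt)

lemma six_mul_powerDominationNumber_le [Fintype V] (h : TriangleMatching G t f) :
    6 * powerDominationNumber G ≤ Fintype.card V := by
  classical
  obtain ⟨c, hc⟩ := h.exists_coloring
  have key : ∀ b, powerDominationNumber G ≤ #((univ.image t).filter fun x => c x = b) := fun b => by
    -- `none` serves the names in `T` that no vertex carries.
    have hr : ∀ x : T, ∃ v : Option V, x ∈ univ.image t → ∃ w, v = some w ∧ t w = x := fun x => by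
      by_cases hx : x ∈ univ.image t
      · obtain ⟨v, -, hv⟩ := mem_image.1 hx
        exact ⟨some v, fun _ => ⟨v, rfl, hv⟩⟩
      · exact ⟨none, fun h => absurd h hx⟩
    choose r hr using hr
    let S : Finset V := ((univ.image t).filter fun x => c x = b).biUnion fun x => (r x).toFinset
    have hS : IsPowerDominatingSet G (S : Set V) := by
      refine h.isPowerDominatingSet hc (b := b) fun v hv => ?_
      have hm : t v ∈ univ.image t := mem_image_of_mem t (mem_univ v)
      obtain ⟨w, hw, htw⟩ := hr _ hm
      exact ⟨w, mem_coe.2 (mem_biUnion.2 ⟨t v, mem_filter.2 ⟨hm, hv⟩, by simp [hw]⟩), htw⟩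
    refine (Nat.sInf_le ⟨S, hS, rfl⟩ : powerDominationNumber G ≤ #S).trans ?_
    refine (card_biUnion_le_card_mul _ _ 1 fun x _ => ?_).trans (mul_one _).le
    cases r x <;> simp
  have hsum := card_filter_add_card_filter_not (s := univ.image t) fun x => c x = true
  simp only [Bool.not_eq_true] at hsum
  have := key true
  have := key false
  have := h.card_eq
  omega

end TriangleMatching

/-! ### Local structure of claw-free diamond-free cubic graphs -/

lemma ClawFree.exists_adj {G : SimpleGraph V} (h : ClawFree G) {v : V} {p : Fin 3 → V}
    (hp : Function.Injective p) (hadj : ∀ i, G.Adj v (p i)) : ∃ i j, G.Adj (p i) (p j) := by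
  by_contra! hn
  refine h ⟨⟨⟨Sum.elim (fun _ => v) p, ?_⟩, ?_⟩⟩
  · rintro (i | i) (j | j) hij
    · exact congrArg _ (Subsingleton.elim _ _)
    · exact absurd hij (hadj j).ne
    · exact absurd hij (hadj i).ne'
    · exact congrArg _ (hp hij)
  · rintro (i | i) (j | j)
    · change G.Adj v v ↔ _; simp [claw]
    · change G.Adj v (p j) ↔ _; simp [claw, hadj]
    · change G.Adj (p i) v ↔ _; simp [claw, (hadj _).symm]
    · change G.Adj (p i) (p j) ↔ _; simp [claw, hn]

lemma DiamondFree.eq_of_adj {G : SimpleGraph V} (h : DiamondFree G) {u v a b : V}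
    (huv : G.Adj u v) (hua : G.Adj u a) (hva : G.Adj v a) (hub : G.Adj u b) (hvb : G.Adj v b) :
    a = b := by
  by_contra hab
  refine h ⟨⟨⟨![a, b, u, v], ?_⟩, ?_⟩⟩
  · intro i j hij
    have := huv.symm
    have := hua.symm
    have := hva.symm
    have := hub.symm
    have := hvb.symm
    fin_cases i <;> fin_cases j <;> simp_all [diamond]
  · intro i j hij
    have := huv.ne
    have := hua.ne
    have := hva.ne
    have := hub.ne
    have := hvb.ne
    fin_cases i <;> fin_cases j <;> simp at hij ⊢ <;> grind

/-- In a claw-free diamond-free cubic graph, the neighborhood of every vertex induces `K₂ + K₁`. -/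
lemma exists_neighbors {G : SimpleGraph V} [G.LocallyFinite] (h3 : G.IsRegularOfDegree 3)
    (hc : ClawFree G) (hd : DiamondFree G) (v : V) :
    ∃ a b c, a ≠ b ∧ (∀ u, G.Adj v u ↔ u = a ∨ u = b ∨ u = c) ∧ G.Adj a b ∧ ¬ G.Adj a c ∧
      ¬ G.Adj b c := by
  classical
  obtain ⟨a, b, c, hab, hac, hbc, hn⟩ := card_eq_three.1 (h3 v)
  have hN : ∀ u, G.Adj v u ↔ u = a ∨ u = b ∨ u = c := fun u => by
    rw [← SimpleGraph.mem_neighborFinset, hn]; simp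
  have build : ∀ x y z, x ≠ z → y ≠ z → (∀ u, G.Adj v u ↔ u = x ∨ u = y ∨ u = z) → G.Adj x y →
      ∃ a b c, a ≠ b ∧ (∀ u, G.Adj v u ↔ u = a ∨ u = b ∨ u = c) ∧ G.Adj a b ∧ ¬ G.Adj a c ∧
        ¬ G.Adj b c := fun x y z hxz hyz hN hxy => by
    have hx := (hN x).2 (by simp)
    have hy := (hN y).2 (by simp)
    have hz := (hN z).2 (by simp)
    exact ⟨x, y, z, hxy.ne, hN, hxy, fun h => hyz (hd.eq_of_adj hx hy hxy hz h),
      fun h => hxz (hd.eq_of_adj hy hx hxy.symm hz h)⟩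
  have hadj : ∀ i, G.Adj v (![a, b, c] i) := by
    intro i; fin_cases i <;> simp [hN]
  obtain ⟨i, j, hij⟩ := hc.exists_adj (p := ![a, b, c])
    (by intro i j; fin_cases i <;> fin_cases j <;>
      simp [hab, hac, hbc, hab.symm, hac.symm, hbc.symm]) hadj
  have : G.Adj a b ∨ G.Adj a c ∨ G.Adj b c := by
    fin_cases i <;> fin_cases j <;> simp [G.adj_comm] at hij ⊢ <;> grind [G.adj_comm]
  rcases this with h | h | h
  · exact build a b c hac hbc hN h
  · exact build a c b hab hbc.symm (fun u => by rw [hN]; tauto) h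
  · exact build b c a hab.symm hac.symm (fun u => by rw [hN]; tauto) h

/-- A triangle is named by its vertex set. The relation `R` and the characterization `hf_iff` of `f
v` (the neighbor sharing no neighbor with `v`) are symmetric in the two vertices, which makes `f` an
involution. -/
lemma exists_triangleMatching {G : SimpleGraph V} [G.LocallyFinite] (h3 : G.IsRegularOfDegree 3)
    (hc : ClawFree G) (hd : DiamondFree G) :
    ∃ (t : V → Set V) (f : V → V), TriangleMatching G t f := by
  choose a b f hne hN hab haf hbf using exists_neighbors h3 hc hd
  have hva : ∀ v, G.Adj v (a v) := fun v => (hN v _).2 (by simp)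
  have hvb : ∀ v, G.Adj v (b v) := fun v => (hN v _).2 (by simp)
  have hvf : ∀ v, G.Adj v (f v) := fun v => (hN v _).2 (by simp)
  let R : V → V → Prop := fun v u => v = u ∨ G.Adj v u ∧ ∃ w, G.Adj v w ∧ G.Adj u w
  have hf_iff : ∀ v u, u = f v ↔ G.Adj v u ∧ ∀ w, G.Adj v w → ¬ G.Adj u w := fun v u => by
    constructor
    · rintro rfl
      refine ⟨hvf v, fun w hw => ?_⟩
      rcases (hN v w).1 hw with rfl | rfl | rfl
      · exact fun h => haf v h.symm
      · exact fun h => hbf v h.symm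
      · exact G.irrefl
    · rintro ⟨h1, h2⟩
      rcases (hN v u).1 h1 with rfl | rfl | rfl
      · exact absurd (hab v) (h2 _ (hvb v))
      · exact absurd (hab v).symm (h2 _ (hva v))
      · rfl
  have hR : ∀ v u, R v u ↔ u = v ∨ u = a v ∨ u = b v := fun v u => by
    constructor
    · rintro (rfl | ⟨h, w, hw, hw'⟩)
      · simp
      · rcases (hN v u).1 h with h | h | h
        · simp [h]
        · simp [h]
        · exact absurd hw' (((hf_iff v u).1 h).2 w hw)
    · rintro (rfl | rfl | rfl)
      · exact .inl rfl
      · exact .inr ⟨hva v, b v, hvb v, hab v⟩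
      · exact .inr ⟨hvb v, a v, hva v, (hab v).symm⟩
  have hsymm : ∀ v u, R v u → R u v := by
    rintro v u (h | ⟨h, w, hw, hw'⟩)
    · exact .inl h.symm
    · exact .inr ⟨h.symm, w, hw', hw⟩
  have htrans : ∀ u v w, R u v → R v w → R u w := fun u v w huv hvw => by
    rcases (hR v u).1 (hsymm _ _ huv) with rfl | rfl | rfl
    · exact hvw
    · rcases (hR v w).1 hvw with rfl | rfl | rfl
      · exact huv
      · exact .inl rfl
      · exact .inr ⟨hab v, v, (hva v).symm, (hvb v).symm⟩
    · rcases (hR v w).1 hvw with rfl | rfl | rfl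
      · exact huv
      · exact .inr ⟨(hab v).symm, v, (hvb v).symm, (hva v).symm⟩
      · exact .inl rfl
  let t : V → Set V := fun v => {u | R v u}
  have ht : ∀ u v, t u = t v ↔ R v u := fun u v => by
    constructor
    · intro h
      have : u ∈ t u := Or.inl rfl
      rwa [h] at this
    · intro h
      ext w
      exact ⟨fun hw => htrans _ _ _ h hw, fun hw => htrans _ _ _ (hsymm _ _ h) hw⟩
  have hfne : ∀ v, ¬ R v (f v) := by
    rintro v (h | ⟨h, w, hw, hw'⟩)
    · exact (hvf v).ne h
    · exact ((hf_iff v _).1 rfl).2 w hw hw'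
  refine ⟨t, f, fun u v => ?_, fun v => ?_, fun v h => hfne v ((ht _ _).1 h), fun v =>
    ⟨a v, b v, (hva v).ne', (hvb v).ne', hne v, fun u => by rw [ht, hR]⟩⟩
  · rw [eq_comm (a := t u), ht, hR, hN]
    have := (hva u).ne
    have := (hvb u).ne
    have := (hvf u).ne
    grind
  · refine ((hf_iff _ _).2 ⟨(hvf v).symm, fun w hw hw' => ?_⟩).symm
    exact ((hf_iff v _).1 rfl).2 w hw' hw

/-! ### The necklace -/

/-- The matching of the necklace: in each bead two edges join the two triangles, and the third
vertex of the second triangle is joined to the third vertex of the first triangle of the next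
bead. -/
def necklaceMatch (k : ℕ) : (ZMod k × Bool) × Fin 3 → (ZMod k × Bool) × Fin 3
  | ((i, s), j) => if j = 2 then ((if s then i + 1 else i - 1, !s), j) else ((i, !s), j)

lemma necklaceMatch_necklaceMatch (k : ℕ) (x : (ZMod k × Bool) × Fin 3) :
    necklaceMatch k (necklaceMatch k x) = x := by
  obtain ⟨⟨i, s⟩, j⟩ := x
  by_cases hj : j = 2 <;> cases s <;> simp [necklaceMatch, hj]

lemma necklaceMatch_fst_ne (k : ℕ) (x : (ZMod k × Bool) × Fin 3) :
    (necklaceMatch k x).1 ≠ x.1 := by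
  obtain ⟨⟨i, s⟩, j⟩ := x
  by_cases hj : j = 2 <;> cases s <;> simp [necklaceMatch, hj]

/-- The cyclic chain of `k` beads, each of which is a triangular prism with one edge between the
triangles removed. -/
def necklace (k : ℕ) : SimpleGraph ((ZMod k × Bool) × Fin 3) where
  Adj x y := (x ≠ y ∧ x.1 = y.1) ∨ y = necklaceMatch k x
  symm := ⟨by
    rintro x y (⟨h1, h2⟩ | rfl)
    · exact .inl ⟨h1.symm, h2.symm⟩
    · exact .inr (necklaceMatch_necklaceMatch k x).symm⟩
  loopless := ⟨by
    rintro x (⟨h, -⟩ | h)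
    · exact h rfl
    · exact necklaceMatch_fst_ne k x (congrArg Prod.fst h.symm)⟩

lemma necklace_triangleMatching (k : ℕ) :
    TriangleMatching (necklace k) Prod.fst (necklaceMatch k) where
  adj_iff _ _ := Iff.rfl
  invol := necklaceMatch_necklaceMatch k
  outer := necklaceMatch_fst_ne k
  fiber := by
    rintro ⟨p, j⟩
    refine ⟨(p, j + 1), (p, j + 2), ?_, ?_, ?_, ?_⟩
    · simp
    · simp
    · simp
    · rintro ⟨q, i⟩
      simp only [Prod.mk.injEq]
      have : ∀ i j : Fin 3, i = j ∨ i = j + 1 ∨ i = j + 2 := by decide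
      have := this i j
      tauto

lemma necklace_connected (k : ℕ) [NeZero k] : (necklace k).Connected := by
  have adj : ∀ x y, y = necklaceMatch k x → (necklace k).Reachable x y := fun x y h =>
    SimpleGraph.Adj.reachable (Or.inr h)
  have tri : ∀ p i j, (necklace k).Reachable (p, i) (p, j) := fun p i j => by
    by_cases h : i = j
    · rw [h]
    · exact SimpleGraph.Adj.reachable (Or.inl ⟨by simpa using h, rfl⟩)
  have side : ∀ i s j, (necklace k).Reachable ((i, false), 0) ((i, s), j) := fun i s j => by
    cases s
    · exact tri _ _ _
    · exact (adj _ ((i, true), 0) (by simp [necklaceMatch])).trans (tri _ _ _)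
  have base : ∀ n : ℕ, (necklace k).Reachable ((0, false), 0) (((n : ZMod k), false), 0) := by
    intro n
    induction n with
    | zero => simp
    | succ n ih =>
      exact ih.trans ((side n true 2).trans ((adj _ ((((n + 1 : ℕ) : ZMod k), false), 2)
        (by simp [necklaceMatch])).trans (tri _ _ _)))
  have all : ∀ x, (necklace k).Reachable ((0, false), 0) x := by
    rintro ⟨⟨i, s⟩, j⟩
    have := base i.val
    rw [ZMod.natCast_zmod_val] at this
    exact this.trans (side i s j)
  exact (SimpleGraph.connected_iff _).2 ⟨fun x y => (all x).symm.trans (all y), ⟨((0, false), 0)⟩⟩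

/-- A bead without selected vertices never has its four inner vertices observed. -/
lemma not_observed_necklace {k : ℕ} {S : Set ((ZMod k × Bool) × Fin 3)} {i : ZMod k}
    (hS : ∀ x ∈ S, x.1.1 ≠ i) {x : (ZMod k × Bool) × Fin 3} (hx : Observed (necklace k) S x) :
    ¬ (x.1.1 = i ∧ x.2 ≠ 2) := by
  induction hx with
  | mem hv => exact fun h => hS _ hv h.1
  | @adj v w hv hvw =>
    rintro ⟨h1, h2⟩
    apply hS _ hv
    rcases hvw with ⟨-, h⟩ | rfl
    · rw [h, h1]
    · obtain ⟨⟨a, s⟩, j⟩ := v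
      by_cases hj : j = 2 <;> simp_all [necklaceMatch]
  | @propagate v w hv hvw hu ihv ihu =>
    rintro ⟨h1, h2⟩
    obtain ⟨⟨a, s⟩, j⟩ := v
    rcases hvw with ⟨hne, h⟩ | rfl
    · obtain ⟨⟨a', s'⟩, j'⟩ := w
      obtain ⟨rfl, rfl⟩ := Prod.mk.inj h
      have hj : j = 2 := by by_contra hj; exact ihv ⟨h1, hj⟩
      subst hj
      -- The end vertex of a bead has two inner neighbors; the one other than `w` is unobserved by
      -- induction, so it blocks propagation.
      have hex : ∀ j' : Fin 3, j' ≠ 2 → ∃ l : Fin 3, l ≠ 2 ∧ l ≠ j' := by decide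
      obtain ⟨l, hl, hlj⟩ := hex j' h2
      exact ihu ((a, s), l) (.inl ⟨by simpa using hl.symm, rfl⟩) (by simpa using hlj) ⟨h1, hl⟩
    · by_cases hj : j = 2 <;> simp_all [necklaceMatch]

lemma le_powerDominationNumber_necklace (k : ℕ) [NeZero k] :
    k ≤ powerDominationNumber (necklace k) := by
  classical
  refine le_csInf ⟨_, univ, fun v => .mem (by simp), rfl⟩ ?_
  rintro _ ⟨S, hS, rfl⟩
  have : (univ : Finset (ZMod k)) ⊆ S.image fun x => x.1.1 := fun i _ => by
    by_contra hi
    refine not_observed_necklace (S := S) (i := i) (fun x hx hxi => hi ?_)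
      (hS ((i, false), 0)) ⟨rfl, by simp⟩
    exact mem_image.2 ⟨x, hx, hxi⟩
  calc k = #(univ : Finset (ZMod k)) := by simp [ZMod.card]
    _ ≤ _ := card_le_card this
    _ ≤ _ := card_image_le

end PowerDomination

theorem theorem1p2 :
    (∀ (V : Type*) [Fintype V] (G : SimpleGraph V) [G.LocallyFinite],
      G.IsRegularOfDegree 3 → PowerDomination.ClawFree G → PowerDomination.DiamondFree G →
        (PowerDomination.powerDominationNumber G : ℚ) ≤ (Fintype.card V : ℚ) / 6) ∧
    (∀ k : ℕ, 1 ≤ k →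
      ∃ (W : Type) (_ : Fintype W) (H : SimpleGraph W) (_ : H.LocallyFinite),
        Fintype.card W = 6 * k ∧ H.Connected ∧ H.IsRegularOfDegree 3 ∧
        PowerDomination.ClawFree H ∧ PowerDomination.DiamondFree H ∧
        (PowerDomination.powerDominationNumber H : ℚ) = (Fintype.card W : ℚ) / 6) := by
  classical
  refine ⟨fun V _ G _ h3 hc hd => ?_, fun k hk => ?_⟩
  · obtain ⟨t, f, h⟩ := PowerDomination.exists_triangleMatching h3 hc hd
    have := h.six_mul_powerDominationNumber_le
    rw [le_div_iff₀ (by norm_num), mul_comm]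
    exact_mod_cast this
  · have : NeZero k := ⟨by omega⟩
    have h := PowerDomination.necklace_triangleMatching k
    have hcard : Fintype.card ((ZMod k × Bool) × Fin 3) = 6 * k := by
      simp [ZMod.card]; omega
    -- For `k = 1` the two ends of the only bead are joined to each other, giving the triangular
    -- prism.
    refine ⟨(ZMod k × Bool) × Fin 3, inferInstance, PowerDomination.necklace k,
      inferInstance, hcard, PowerDomination.necklace_connected k,
      h.isRegularOfDegree, h.clawFree, h.diamondFree,
      ?_⟩
    have h1 := h.six_mul_powerDominationNumber_le
    have h2 := PowerDomination.le_powerDominationNumber_necklace k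
    rw [hcard] at h1 ⊢
    rw [le_antisymm (by omega) h2]
    push_cast
    ring
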